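/- Identify each subset of $\omega$ with its characteristic function, so that an ultrafilter on $\omega$ is a subspace of the Cantor space $2^\omega$. A subset of $2^\omega$ has the \emph{perfect set property} if it is countable or contains a perfect set, that is, a non-empty closed subset of $2^\omega$ without isolated points. Let $\mathrm{MA(countable)}$ be the statement that for every non-empty countable partial order $\mathbb{P}$ and every family $\mathcal{D}$ of fewer than $\mathfrak{c}=2^{\aleph_0}$ dense subsets of $\mathbb{P}$ there is a filter $G\subseteq\mathbb{P}$ that meets every $D\in\mathcal{D}$. Theorem. Assume $\mathrm{MA(countable)}$. Then there exists a non-principal ultrafilter $\mathcal{U}\subseteq 2^\omega$ such that $A\cap\mathcal{U}$ has the perfect set property for every analytic $A\subseteq 2^\omega$. In particular, every (relatively) closed subset of $\mathcal{U}$, regarded as a subset of $2^\omega$, has the perfect set property. -/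

import Mathlib

/-- `MA(countable)`: for every non-empty countable partial order `P` and every family `𝒟` of fewer
than continuum many dense subsets of `P`, some filter on `P` meets every member of `𝒟`.
(Stronger conditions are smaller; `D` is dense if below every `p` there is an element of `D`.) -/
def MACountable : Prop :=
  ∀ (P : Type) [PartialOrder P] [Countable P] [Nonempty P] (𝒟 : Set (Set P)),
    Cardinal.mk 𝒟 < Cardinal.continuum →
    (∀ D ∈ 𝒟, ∀ p : P, ∃ d ∈ D, d ≤ p) →
    ∃ G : Order.PFilter P, ∀ D ∈ 𝒟, ∃ d ∈ D, d ∈ G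

/-- An ultrafilter on `ℕ`, viewed as a subset of the Cantor space `ℕ → Bool`: the set of all
characteristic functions of its members. -/
def Ultrafilter.toCantor (U : Ultrafilter ℕ) : Set (ℕ → Bool) :=
  {x | {n : ℕ | x n = true} ∈ U}

/-- A subset of a topological space has the perfect set property if it is countable or contains
a perfect set, that is, a non-empty closed subset of the whole space without isolated points. -/
def HasPerfectSetProperty {X : Type*} [TopologicalSpace X] (A : Set X) : Prop :=
  A.Countable ∨ ∃ P : Set X, P ⊆ A ∧ P.Nonempty ∧ Perfect P

open Cardinal Set Filter Topology

/-! Every analytic set is empty or the range of a continuous `f` on the Baire space. If its trace on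
the ultrafilter is uncountable, the graph of `f` over that trace contains a countable sequence `q`
with crowded second coordinates. There are only continuum many such `q`, so a recursion of length
`𝔠` can treat them all while building a family `F` that generates the ultrafilter. For a `q`
compatible with `F`, `MACountable.exists_isPerfectIndex` adds a set `s` contained in every set coded
by a crowded subsequence whose first coordinates lie in a compact set. By
`IsPerfectIndex.exists_perfect`, the closure of that subsequence is perfect; compactness keeps it in
the range of `f`, and its points code supersets of `s`, hence members of the ultrafilter. -/

/-- A family of subsets of `ℕ` has the strong finite intersection property if all of its finite
subfamilies have an infinite intersection. -/
def StrongFIP (F : Set (Set ℕ)) : Prop :=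
  ∀ T ⊆ F, T.Finite → (⋂₀ T).Infinite

theorem StrongFIP.mono {F F' : Set (Set ℕ)} (h : StrongFIP F') (hF : F ⊆ F') : StrongFIP F :=
  fun T hT => h T (hT.trans hF)

theorem StrongFIP.insert_of_inter {F : Set (Set ℕ)} {s : Set ℕ}
    (h : ∀ T ⊆ F, T.Finite → (s ∩ ⋂₀ T).Infinite) : StrongFIP (insert s F) := by
  intro T hT hfin
  refine (h (T \ {s}) (by grind) hfin.sdiff).mono ?_
  rintro n ⟨hs, hn⟩ t ht
  by_cases hts : t = s
  · exact hts ▸ hs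
  · exact hn t ⟨ht, hts⟩

/-- A directed union of families with the strong finite intersection property, indexed by a
linear order, has this property. -/
theorem StrongFIP.image_of_forall_Iic {ι : Type*} [LinearOrder ι] (S : ι → Set ℕ) (J : Set ι)
    (h : ∀ j ∈ J, StrongFIP (S '' Iic j)) : StrongFIP (S '' J) := by
  intro T hT hfin
  obtain ⟨J', hJ', hfin', rfl⟩ := exists_subset_image_finite_and.1 ⟨T, hT, hfin, rfl⟩
  rcases J'.eq_empty_or_nonempty with rfl | hne
  · simpa using Set.infinite_univ
  · obtain ⟨m, hm, hmax⟩ := hfin'.exists_maximalFor id _ hne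
    refine h m (hJ' hm) _ (image_mono fun j hj => ?_) hfin
    rcases le_total j m with hjm | hjm
    · exact hjm
    · exact hmax hj hjm

theorem StrongFIP.exists_ultrafilter {F : Set (Set ℕ)} (h : StrongFIP F) :
    ∃ U : Ultrafilter ℕ, (U : Filter ℕ) ≤ cofinite ∧ ∀ s ∈ F, s ∈ U := by
  have hne : (generate F ⊓ cofinite).NeBot := by
    refine inf_neBot_iff.2 fun {s} hs {t} ht => ?_
    obtain ⟨T, hTF, hT, hTs⟩ := mem_generate_iff.1 hs
    obtain ⟨n, hn, hnt⟩ := (h T hTF hT).exists_notMem_finite (mem_cofinite.1 ht)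
    exact ⟨n, hTs hn, by simpa using hnt⟩
  refine ⟨Ultrafilter.of (generate F ⊓ cofinite), (Ultrafilter.of_le _).trans inf_le_right, fun s hs => ?_⟩
  exact ((Ultrafilter.of_le _).trans inf_le_left) (GenerateSets.basic hs)

theorem StrongFIP.of_ultrafilter {U : Ultrafilter ℕ} (hU : (U : Filter ℕ) ≤ cofinite)
    {F : Set (Set ℕ)} (hF : ∀ s ∈ F, s ∈ U) : StrongFIP F := by
  intro T hT hfin hinf
  have h1 : ⋂₀ T ∈ (U : Filter ℕ) := (sInter_mem hfin).2 fun s hs => hF s (hT hs)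
  have h2 : (⋂₀ T)ᶜ ∈ (U : Filter ℕ) := hU hinf.compl_mem_cofinite
  exact (Ultrafilter.compl_notMem_iff.2 h1) h2

/-- Transfinite construction of length continuum of a family with the strong finite intersection
property that satisfies continuum many upward closed requirements. -/
theorem exists_strongFIP_of_extension {τ : Type} [Nonempty τ] (hτ : #τ ≤ 𝔠)
    (P : τ → Set (Set ℕ) → Prop) (hmono : ∀ t F F', F ⊆ F' → P t F → P t F')
    (hext : ∀ t (F : Set (Set ℕ)), #F < 𝔠 → StrongFIP F → ∃ s, StrongFIP (insert s F) ∧ P t (insert s F)) :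
    ∃ F : Set (Set ℕ), StrongFIP F ∧ ∀ t, P t F := by
  have hcard : #τ ≤ #(continuum.ord.ToType) := by simpa using hτ
  obtain ⟨g⟩ := hcard
  let e : continuum.ord.ToType → τ := Function.invFun g
  have he : Function.Surjective e := Function.invFun_surjective g.injective
  have hext' : ∀ t (F : Set (Set ℕ)), ∃ s, #F < 𝔠 → StrongFIP F → StrongFIP (insert s F) ∧ P t (insert s F) := by
    intro t F
    by_cases h : #F < 𝔠 ∧ StrongFIP F
    · obtain ⟨s, hs⟩ := hext t F h.1 h.2
      exact ⟨s, fun _ _ => hs⟩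
    · exact ⟨∅, fun h1 h2 => (h ⟨h1, h2⟩).elim⟩
  choose c hc using hext'
  let S : continuum.ord.ToType → Set ℕ := WellFounded.fix (r := (· < ·)) wellFounded_lt
    fun a ih => c (e a) {s | ∃ b, ∃ h : b < a, ih b h = s}
  have hS : ∀ a, S a = c (e a) (S '' Iio a) := by
    intro a
    have := WellFounded.fix_eq (r := ((· < ·) : continuum.ord.ToType → continuum.ord.ToType → Prop)) wellFounded_lt
      (fun a (ih : ∀ b, b < a → Set ℕ) => c (e a) {s | ∃ b, ∃ h : b < a, ih b h = s}) a
    refine this.trans (congrArg _ ?_)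
    ext s
    simp [S]
  have hins : ∀ a, insert (S a) (S '' Iio a) = S '' Iic a := fun a => by
    rw [← image_insert_eq, Iio_insert]
  have hstep : ∀ a, StrongFIP (S '' Iio a) → StrongFIP (S '' Iic a) ∧ P (e a) (S '' Iic a) := by
    intro a ha
    rw [← hins a, hS a]
    exact hc _ _ (mk_image_le.trans_lt ((by simpa using mk_Iio_lt a (by simp)))) ha
  have hfip : ∀ a, StrongFIP (S '' Iio a) := by
    intro a
    induction a using WellFoundedLT.induction with
    | ind a ih => exact .image_of_forall_Iic S _ fun b hb => (hstep b (ih b hb)).1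
  refine ⟨S '' univ, .image_of_forall_Iic S _ fun a _ => (hstep a (hfip a)).1, fun t => ?_⟩
  obtain ⟨a, rfl⟩ := he t
  exact hmono _ _ _ (image_mono (subset_univ _)) (hstep a (hfip a)).2

/-- An uncountable subset of a second countable `T₁` space contains a sequence each of whose terms
is an accumulation point of its range. -/
theorem exists_seq_crowded {X : Type*} [TopologicalSpace X] [SecondCountableTopology X] [T1Space X]
    {Z : Set X} (hZ : ¬ Z.Countable) :
    ∃ q : ℕ → X, (∀ i, q i ∈ Z) ∧ ∀ i, ∀ U ∈ 𝓝 (q i), ∃ j, q j ∈ U ∧ q j ≠ q i := by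
  -- The condensation points of `Z` in `Z`: all but countably many points of `Z`, and a crowded set.
  -- A dense sequence in them will do.
  let Z' : Set X := {z ∈ Z | ∀ U ∈ 𝓝 z, ¬ (U ∩ Z).Countable}
  have hdiff : (Z \ Z').Countable := by
    have h : ∀ z ∈ Z \ Z', ∃ U ∈ 𝓝 z, (U ∩ Z).Countable := by
      rintro z ⟨hz, hz'⟩
      by_contra! hcon
      exact hz' ⟨hz, hcon⟩
    choose! f hf hfc using h
    obtain ⟨t, htZ, htc, hcov⟩ := TopologicalSpace.countable_cover_nhdsWithin
      (f := f) (s := Z \ Z') fun z hz => mem_nhdsWithin_of_mem_nhds (hf z hz)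
    refine (htc.biUnion fun z hz => hfc z (htZ hz)).mono fun z hz => ?_
    obtain ⟨y, hy, hzy⟩ := mem_iUnion₂.1 (hcov hz)
    exact mem_iUnion₂.2 ⟨y, hy, hzy, hz.1⟩
  have hcond : ∀ z ∈ Z', ∀ U ∈ 𝓝 z, ∃ y ∈ U ∩ Z', y ≠ z := by
    intro z hz U hU
    by_contra! hcon
    refine hz.2 U hU ((hdiff.union (countable_singleton z)).mono ?_)
    rintro y ⟨hyU, hyZ⟩
    by_cases hy : y ∈ Z'
    · exact Or.inr (hcon y ⟨hyU, hy⟩)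
    · exact Or.inl ⟨hyZ, hy⟩
  have hne : Nonempty Z' := by
    by_contra hcon
    rw [not_nonempty_iff, isEmpty_coe_sort] at hcon
    rw [hcon, sdiff_empty] at hdiff
    exact hZ hdiff
  refine ⟨fun i => TopologicalSpace.denseSeq Z' i,
    fun i => (TopologicalSpace.denseSeq Z' i).2.1, fun i U hU => ?_⟩
  obtain ⟨V, hVU, hV, hiV⟩ := mem_nhds_iff.1 hU
  obtain ⟨y, ⟨hyV, hyZ⟩, hne⟩ := hcond _ (TopologicalSpace.denseSeq Z' i).2 V (hV.mem_nhds hiV)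
  obtain ⟨j, hj⟩ := (TopologicalSpace.denseRange_denseSeq Z').exists_mem_open
    ((hV.inter (isOpen_compl_singleton (x := (TopologicalSpace.denseSeq Z' i : X)))).preimage
      continuous_subtype_val) ⟨⟨y, hyZ⟩, hyV, hne⟩
  exact ⟨j, hVU hj.1, hj.2⟩

/-! ### Forcing with finite approximations to a perfect set -/

/-- The subset of `ℕ` coded by a point of the Cantor space. -/
def codedSet (v : ℕ → Bool) : Set ℕ := {n | v n = true}

/-- Every term of `q` is a limit of terms of `q` with a different second coordinate. -/
def SndCrowded (q : ℕ → (ℕ → ℕ) × (ℕ → Bool)) : Prop :=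
  ∀ i N, ∃ j, (∀ n < N, (q j).1 n = (q i).1 n) ∧ (∀ n < N, (q j).2 n = (q i).2 n) ∧
    (q j).2 ≠ (q i).2

/-- Forcing conditions for a perfect set of limits of `q` with a large intersection: finitely many
terms of the sequence, a precision, and a finite subset of the sets that these terms code. -/
@[ext]
structure PerfectCondition (q : ℕ → (ℕ → ℕ) × (ℕ → Bool)) where
  /-- indices of terms that are put into the perfect set -/
  idx : Finset ℕ
  /-- the length up to which the first coordinates are decided -/
  level : ℕ
  /-- a finite part of the intersection -/
  stem : Finset ℕ
  nonempty : idx.Nonempty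
  stem_subset : ∀ i ∈ idx, ∀ n ∈ stem, (q i).2 n = true

namespace PerfectCondition

variable {q : ℕ → (ℕ → ℕ) × (ℕ → Bool)}

/-- A new term must copy the first coordinate of an old one below the old level. Thus a condition in
the filter leaves only finitely many values at each coordinate below its level. -/
instance : PartialOrder (PerfectCondition q) where
  le p r := r.idx ⊆ p.idx ∧ r.level ≤ p.level ∧ r.stem ⊆ p.stem ∧
    ∀ i ∈ p.idx, ∃ j ∈ r.idx, ∀ n < r.level, (q i).1 n = (q j).1 n
  le_refl p := ⟨subset_rfl, le_rfl, subset_rfl, fun i hi => ⟨i, hi, fun _ _ => rfl⟩⟩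
  le_trans p r t hpr hrt := by
    refine ⟨hrt.1.trans hpr.1, hrt.2.1.trans hpr.2.1, hrt.2.2.1.trans hpr.2.2.1, fun i hi => ?_⟩
    obtain ⟨j, hj, hij⟩ := hpr.2.2.2 i hi
    obtain ⟨k, hk, hjk⟩ := hrt.2.2.2 j hj
    exact ⟨k, hk, fun n hn => (hij n (hn.trans_le hrt.2.1)).trans (hjk n hn)⟩
  le_antisymm p r hpr hrp := PerfectCondition.ext (hrp.1.antisymm hpr.1)
    (hrp.2.1.antisymm hpr.2.1) (hrp.2.2.1.antisymm hpr.2.2.1)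

instance : Countable (PerfectCondition q) := by
  refine Function.Injective.countable
    (f := fun p : PerfectCondition q => (p.idx, p.level, p.stem)) fun p r h => ?_
  simp only [Prod.mk.injEq] at h
  exact PerfectCondition.ext h.1 h.2.1 h.2.2

instance : Nonempty (PerfectCondition q) := ⟨⟨{0}, 0, ∅, by simp, by simp⟩⟩

theorem exists_le_level (p : PerfectCondition q) (k : ℕ) :
    ∃ r : PerfectCondition q, k ≤ r.level ∧ r ≤ p :=
  ⟨⟨p.idx, max p.level k, p.stem, p.nonempty, p.stem_subset⟩, le_max_right _ _,
    subset_rfl, le_max_left _ _, subset_rfl, fun i hi => ⟨i, hi, fun _ _ => rfl⟩⟩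

theorem exists_le_stem {F : Set (Set ℕ)}
    (hF : StrongFIP (F ∪ range fun i => codedSet (q i).2)) {T : Set (Set ℕ)} (hT : T ⊆ F)
    (hfin : T.Finite) (p : PerfectCondition q) (N : ℕ) :
    ∃ r : PerfectCondition q, (∃ m ∈ r.stem, N < m ∧ m ∈ ⋂₀ T) ∧ r ≤ p := by
  have hinf := hF (T ∪ (fun i => codedSet (q i).2) '' p.idx)
    (union_subset_union hT (image_subset_range _ _)) (hfin.union (p.idx.finite_toSet.image _))
  obtain ⟨m, hm, hNm⟩ := hinf.exists_gt N
  refine ⟨⟨p.idx, p.level, insert m p.stem, p.nonempty, ?_⟩,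
    ⟨m, Finset.mem_insert_self _ _, hNm, fun t ht => hm t (Or.inl ht)⟩,
    subset_rfl, le_rfl, Finset.subset_insert _ _, fun i hi => ⟨i, hi, fun _ _ => rfl⟩⟩
  intro i hi n hn
  rcases Finset.mem_insert.1 hn with rfl | hn
  · exact hm _ (Or.inr ⟨i, hi, rfl⟩)
  · exact p.stem_subset i hi n hn

theorem exists_le_split (hq : SndCrowded q) (p : PerfectCondition q) {i : ℕ} (hi : i ∈ p.idx)
    (N : ℕ) : ∃ r : PerfectCondition q,
      (∃ j ∈ r.idx, (∀ n < N, (q j).2 n = (q i).2 n) ∧ (q j).2 ≠ (q i).2) ∧ r ≤ p := by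
  -- Agreement up to `p.level` makes the extension legal; agreement past the largest element of the
  -- stem keeps the stem inside the new coded set.
  obtain ⟨j, hj1, hj2, hne⟩ := hq i (max N (max p.level (p.stem.sup id + 1)))
  refine ⟨⟨insert j p.idx, p.level, p.stem, Finset.insert_nonempty _ _, ?_⟩,
    ⟨j, Finset.mem_insert_self _ _, fun n hn => hj2 n (by omega), hne⟩,
    Finset.subset_insert _ _, le_rfl, subset_rfl, ?_⟩
  · intro k hk n hn
    rcases Finset.mem_insert.1 hk with rfl | hk
    · have : n ≤ p.stem.sup id := Finset.le_sup (f := id) hn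
      rw [hj2 n (by omega)]
      exact p.stem_subset i hi n hn
    · exact p.stem_subset k hk n hn
  · intro k hk
    rcases Finset.mem_insert.1 hk with rfl | hk
    · exact ⟨i, hi, fun n hn => hj1 n (by omega)⟩
    · exact ⟨k, hk, fun _ _ => rfl⟩

end PerfectCondition

/-- The index set of a subsequence whose second coordinates form a crowded set of supersets of `s`,
while the first coordinates form a relatively compact set. -/
structure IsPerfectIndex (q : ℕ → (ℕ → ℕ) × (ℕ → Bool)) (s W : Set ℕ) : Prop where
  nonempty : W.Nonempty
  finite_coord : ∀ n, ((fun i => (q i).1 n) '' W).Finite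
  crowded : ∀ i ∈ W, ∀ N, ∃ j ∈ W, (∀ n < N, (q j).2 n = (q i).2 n) ∧ (q j).2 ≠ (q i).2
  subset : ∀ i ∈ W, s ⊆ codedSet (q i).2

theorem mk_finset_lt_continuum {α : Type} (h : #α < 𝔠) : #(Finset α) < 𝔠 := by
  rcases finite_or_infinite α with hα | hα
  · exact (lt_aleph0_of_finite _).trans aleph0_lt_continuum
  · rwa [mk_finset_of_infinite]

theorem MACountable.exists_isPerfectIndex (hMA : MACountable) {F : Set (Set ℕ)} (hcard : #F < 𝔠)
    {q : ℕ → (ℕ → ℕ) × (ℕ → Bool)} (hq : SndCrowded q)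
    (hF : StrongFIP (F ∪ range fun i => codedSet (q i).2)) :
    ∃ s W, StrongFIP (insert s F) ∧ IsPerfectIndex q s W := by
  let D₁ : ℕ → Set (PerfectCondition q) := fun k => {p | k ≤ p.level}
  let D₂ : Finset F × ℕ → Set (PerfectCondition q) := fun a =>
    {p | ∃ m ∈ p.stem, a.2 < m ∧ ∀ t ∈ a.1, m ∈ (t : Set ℕ)}
  let D₃ : ℕ × ℕ → Set (PerfectCondition q) := fun a =>
    -- The second alternative makes this set dense even when `a.1` cannot be added; directedness of
    -- the filter rules it out for indices that occur.
    {p | (∃ j ∈ p.idx, (∀ n < a.2, (q j).2 n = (q a.1).2 n) ∧ (q j).2 ≠ (q a.1).2) ∨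
      ∀ r ≤ p, a.1 ∉ r.idx}
  have hlt : #(range D₁ ∪ range D₂ ∪ range D₃ : Set (Set (PerfectCondition q))) < 𝔠 := by
    have hc : ∀ {β : Type} [Countable β] (D : β → Set (PerfectCondition q)), #(range D) < 𝔠 :=
      fun D => (countable_range D).le_aleph0.trans_lt aleph0_lt_continuum
    have h₂ : #(range D₂) < 𝔠 := by
      refine mk_range_le.trans_lt ?_
      rw [mk_prod, lift_id, lift_id]
      exact mul_lt_of_lt aleph0_le_continuum (mk_finset_lt_continuum hcard)
        (by simpa using aleph0_lt_continuum)
    exact (mk_union_le _ _).trans_lt (add_lt_of_lt aleph0_le_continuum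
      ((mk_union_le _ _).trans_lt (add_lt_of_lt aleph0_le_continuum (hc D₁) h₂)) (hc D₃))
  obtain ⟨G, hG⟩ := hMA (PerfectCondition q) _ hlt (by
    rintro D ((⟨k, rfl⟩ | ⟨⟨T, N⟩, rfl⟩) | ⟨⟨i, N⟩, rfl⟩) p
    · exact p.exists_le_level k
    · obtain ⟨r, ⟨m, hm, hNm, hmT⟩, hr⟩ := p.exists_le_stem hF
        (T := Subtype.val '' (T : Set F)) (by simp) (T.finite_toSet.image _) N
      exact ⟨r, ⟨m, hm, hNm, fun t ht => hmT _ ⟨t, ht, rfl⟩⟩, hr⟩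
    · by_cases h : ∃ r ≤ p, i ∈ r.idx
      · obtain ⟨r, hr, hi⟩ := h
        obtain ⟨d, hd, hdr⟩ := r.exists_le_split hq hi N
        exact ⟨d, Or.inl hd, hdr.trans hr⟩
      · exact ⟨p, Or.inr fun r hr hi => h ⟨r, hr, hi⟩, le_rfl⟩)
  have hdir : ∀ p ∈ G, ∀ r ∈ G, ∃ t ∈ G, t ≤ p ∧ t ≤ r := fun p hp r hr => G.directed p hp r hr
  refine ⟨{n | ∃ p ∈ G, n ∈ p.stem}, {i | ∃ p ∈ G, i ∈ p.idx}, ?_, ?_, ?_, ?_, ?_⟩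
  · refine .insert_of_inter fun T hT hfin => ?_
    rw [infinite_iff_exists_gt]
    intro N
    lift T to Finset (Set ℕ) using hfin
    classical
    obtain ⟨d, ⟨m, hm, hNm, hmT⟩, hdG⟩ := hG (D₂ (T.subtype (· ∈ F), N))
      (Or.inl (Or.inr (mem_range_self _)))
    exact ⟨m, ⟨⟨d, hdG, hm⟩, fun t ht => hmT ⟨t, hT ht⟩ (by simpa using ht)⟩, hNm⟩
  · obtain ⟨p, hp⟩ := G.nonempty
    obtain ⟨i, hi⟩ := p.nonempty
    exact ⟨i, p, hp, hi⟩
  · intro n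
    obtain ⟨d, hd, hdG⟩ := hG (D₁ (n + 1)) (Or.inl (Or.inl (mem_range_self _)))
    refine (d.idx.finite_toSet.image fun i => (q i).1 n).subset ?_
    rintro _ ⟨i, ⟨p, hp, hi⟩, rfl⟩
    obtain ⟨t, -, htp, htd⟩ := hdir p hp d hdG
    obtain ⟨j, hj, hij⟩ := htd.2.2.2 i (htp.1 hi)
    exact ⟨j, hj, (hij n (Nat.lt_of_succ_le hd)).symm⟩
  · rintro i ⟨p, hp, hi⟩ N
    obtain ⟨d, hd, hdG⟩ := hG (D₃ (i, N)) (Or.inr (mem_range_self _))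
    rcases hd with ⟨j, hj, hji⟩ | hd
    · exact ⟨j, ⟨d, hdG, hj⟩, hji⟩
    · obtain ⟨t, -, htp, htd⟩ := hdir p hp d hdG
      exact (hd t htd (htp.1 hi)).elim
  · rintro i ⟨p, hp, hi⟩ n ⟨r, hr, hn⟩
    obtain ⟨t, -, htp, htr⟩ := hdir p hp r hr
    exact t.stem_subset i (htp.1 hi) n (htr.2.2.1 hn)

/-! ### From index sets to perfect sets -/

theorem exists_cylinder_subset_of_mem_nhds {x : ℕ → Bool} {V : Set (ℕ → Bool)} (hV : V ∈ 𝓝 x) :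
    ∃ N, ∀ y : ℕ → Bool, (∀ n < N, y n = x n) → y ∈ V := by
  obtain ⟨_, ⟨z, N, rfl⟩, hx, hsub⟩ :=
    (PiNat.isTopologicalBasis_cylinders fun _ : ℕ => Bool).mem_nhds_iff.1 hV
  refine ⟨N, fun y hy => hsub ?_⟩
  rw [PiNat.mem_cylinder_iff] at hx ⊢
  exact fun n hn => (hy n hn).trans (hx n hn)

theorem IsPerfectIndex.exists_perfect {q : ℕ → (ℕ → ℕ) × (ℕ → Bool)} {s W : Set ℕ}
    (h : IsPerfectIndex q s W) {f : (ℕ → ℕ) → ℕ → Bool} (hf : Continuous f)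
    (hqf : ∀ i, f (q i).1 = (q i).2) :
    ∃ P : Set (ℕ → Bool), P ⊆ range f ∧ (∀ x ∈ P, s ⊆ codedSet x) ∧ P.Nonempty ∧ Perfect P := by
  refine ⟨closure ((fun i => (q i).2) '' W), ?_, ?_, (h.nonempty.image _).closure, ?_⟩
  · let K : Set (ℕ → ℕ) := univ.pi fun n => (fun i => (q i).1 n) '' W
    have hK : IsCompact K := isCompact_univ_pi fun n => (h.finite_coord n).isCompact
    refine (closure_minimal ?_ (hK.image hf).isClosed).trans (image_subset_range f K)
    rintro _ ⟨i, hi, rfl⟩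
    exact ⟨(q i).1, fun n _ => ⟨i, hi, rfl⟩, hqf i⟩
  · intro x hx n hn
    have hcl : IsClosed {y : ℕ → Bool | y n = true} :=
      isClosed_eq (continuous_apply n) continuous_const
    refine closure_minimal ?_ hcl hx
    rintro _ ⟨i, hi, rfl⟩
    exact h.subset i hi hn
  · refine Preperfect.perfect_closure (preperfect_iff_nhds.2 ?_)
    rintro _ ⟨i, hi, rfl⟩ V hV
    obtain ⟨N, hN⟩ := exists_cylinder_subset_of_mem_nhds hV
    obtain ⟨j, hj, hji, hne⟩ := h.crowded i hi N
    exact ⟨(q j).2, ⟨hN _ hji, j, hj, rfl⟩, hne⟩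

/-- An uncountable set in the range of a function on the Baire space contains a sequence that
lifts to a sequence in the graph with crowded second coordinates. -/
theorem exists_sndCrowded {f : (ℕ → ℕ) → ℕ → Bool} {B : Set (ℕ → Bool)} (hB : B ⊆ range f)
    (hunc : ¬ B.Countable) : ∃ q, SndCrowded q ∧ ∀ i, (q i).2 ∈ B ∧ f (q i).1 = (q i).2 := by
  have hB' : ∀ b ∈ B, ∃ x, f x = b := fun b hb => hB hb
  choose! g hg using hB'
  -- With one chosen preimage per point, distinct points of `Z` have distinct second coordinates.
  let Z : Set ((ℕ → ℕ) × (ℕ → Bool)) := (fun b => (g b, b)) '' B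
  have hZ : ¬ Z.Countable := fun hc => hunc <| by
    simpa [Z, image_image] using hc.image Prod.snd
  have hmem : ∀ z ∈ Z, z.2 ∈ B ∧ g z.2 = z.1 := by
    rintro _ ⟨b, hb, rfl⟩
    exact ⟨hb, rfl⟩
  obtain ⟨q, hqZ, hq⟩ := exists_seq_crowded hZ
  refine ⟨q, fun i N => ?_, fun i => ⟨(hmem _ (hqZ i)).1, ?_⟩⟩
  · have h1 := (PiNat.isOpen_cylinder (fun _ : ℕ => ℕ) (q i).1 N).mem_nhds
      (PiNat.self_mem_cylinder _ _)
    have h2 := (PiNat.isOpen_cylinder (fun _ : ℕ => Bool) (q i).2 N).mem_nhds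
      (PiNat.self_mem_cylinder _ _)
    obtain ⟨j, ⟨hj1, hj2⟩, hne⟩ := hq i _ (prod_mem_nhds h1 h2)
    refine ⟨j, PiNat.mem_cylinder_iff.1 hj1, PiNat.mem_cylinder_iff.1 hj2, fun heq => hne ?_⟩
    refine Prod.ext ?_ heq
    rw [← (hmem _ (hqZ j)).2, ← (hmem _ (hqZ i)).2, heq]
  · rw [← (hmem _ (hqZ i)).2]
    exact hg _ (hmem _ (hqZ i)).1

theorem mainTheorem7 (hMA : MACountable) :
    ∃ U : Ultrafilter ℕ,
      (∀ n : ℕ, U ≠ pure n) ∧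
      (∀ A : Set (ℕ → Bool), MeasureTheory.AnalyticSet A →
        HasPerfectSetProperty (A ∩ U.toCantor)) ∧
      (∀ C : Set U.toCantor, IsClosed C →
        HasPerfectSetProperty ((Subtype.val : U.toCantor → (ℕ → Bool)) '' C)) := by
  obtain ⟨F, hF, hP⟩ := exists_strongFIP_of_extension (τ := ℕ → (ℕ → ℕ) × (ℕ → Bool)) (by simp)
    (fun q F => SndCrowded q → StrongFIP (F ∪ range fun i => codedSet (q i).2) →
      ∃ s ∈ F, ∃ W, IsPerfectIndex q s W)
    (fun q F F' hFF' h hq hfip => by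
      obtain ⟨s, hs, hW⟩ := h hq (hfip.mono (union_subset_union_left _ hFF'))
      exact ⟨s, hFF' hs, hW⟩)
    (fun q F hcard hF => by
      by_cases h : SndCrowded q ∧ StrongFIP (F ∪ range fun i => codedSet (q i).2)
      · obtain ⟨s, W, hs, hW⟩ := hMA.exists_isPerfectIndex hcard h.1 h.2
        exact ⟨s, hs, fun _ _ => ⟨s, mem_insert _ _, W, hW⟩⟩
      -- An incompatible `q` stays incompatible with larger families, so its requirement is vacuous
      -- and adding `univ` is harmless.
      · refine ⟨univ, .insert_of_inter fun T hT hfin => by simpa using hF T hT hfin,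
          fun hq hfip => (h ⟨hq, ?_⟩).elim⟩
        exact hfip.mono (union_subset_union_left _ (subset_insert _ _)))
  obtain ⟨U, hU, hFU⟩ := hF.exists_ultrafilter
  have hA : ∀ A : Set (ℕ → Bool), MeasureTheory.AnalyticSet A →
      HasPerfectSetProperty (A ∩ U.toCantor) := by
    intro A hA
    rw [HasPerfectSetProperty, or_iff_not_imp_left]
    intro hunc
    rw [MeasureTheory.AnalyticSet] at hA
    rcases hA with rfl | ⟨f, hf, rfl⟩
    · simp at hunc
    · obtain ⟨q, hq, hqB⟩ := exists_sndCrowded inter_subset_left hunc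
      -- Compatibility is automatic: `F` and the sets coded by `q` all lie in one non-principal
      -- ultrafilter.
      obtain ⟨s, hs, W, hW⟩ := hP q hq (.of_ultrafilter hU (by
        rintro s (hs | ⟨i, rfl⟩)
        · exact hFU s hs
        · exact (hqB i).1.2))
      obtain ⟨P, hPf, hPs, hne, hPp⟩ := hW.exists_perfect hf fun i => (hqB i).2
      exact ⟨P, fun x hx => ⟨hPf hx, mem_of_superset (hFU s hs) (hPs x hx)⟩, hne, hPp⟩
  refine ⟨U, ?_, hA, ?_⟩
  · rintro n rfl
    have : ({n}ᶜ : Set ℕ) ∈ (pure n : Ultrafilter ℕ) := hU (finite_singleton n).compl_mem_cofinite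
    exact (Ultrafilter.mem_pure.1 this) rfl
  · intro C hC
    have : PolishSpace Bool := inferInstance
    obtain ⟨C', hC', rfl⟩ := isClosed_induced_iff.1 hC
    rw [Subtype.image_preimage_coe, inter_comm]
    exact hA C' hC'.analyticSet
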